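/- All graphs are finite and simple. A connected graph with $n$ vertices and $n+c-1$ edges is called $c$-cyclic. A $c$-cyclic degree sequence is a sequence $\pi=(d_1\ge d_2\ge\dots\ge d_n)$ such that some $c$-cyclic graph on vertices $v_1,\dots,v_n$ satisfies $d(v_i)=d_i$ for all $i$; $\Gamma(\pi)$ is the set of all connected graphs on $v_1,\dots,v_n$ with $d(v_i)=d_i$ for all $i$. A symmetric function $f(x,y)$ of two positive real variables is escalating (resp. de-escalating) if $$f(x_1,x_2)+f(y_1,y_2)\ \ge\ (\text{resp. }\le)\ \ f(x_2,y_1)+f(x_1,y_2)\qquad\text{for all } x_1\ge y_1>0,\ x_2\ge y_2>0,$$ with strict inequality whenever $x_1>y_1$ and $x_2>y_2$. Put $M_f(G)=\sum_{uv\in E(G)}f(d(u),d(v))$. A connected graph $G$ is a BFS-graph with respect to the ordering $v_1\prec v_2\prec\dots\prec v_n$ of its vertices if, writing $h(v)$ for the distance from $v_1$ to $v$: (i) $d(v_1)\ge\dots\ge d(v_n)$ and $h(v_1)\le\dots\le h(v_n)$; (ii) whenever $v\in N(u)\setminus N(w)$, $z\in N(w)\setminus N(u)$, $h(u)=h(w)=h(v)-1=h(z)-1$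 and $u\prec w$, then $v\prec z$. Theorem. Let $c\ge 0$ and let $\pi=(d_1,\dots,d_n)$ be a $c$-cyclic degree sequence with $d_n=1$. If $f$ is escalating (resp. de-escalating), then there is a graph $G\in\Gamma(\pi)$ that maximizes (resp. minimizes) $M_f$ over $\Gamma(\pi)$, that is a BFS-graph with respect to the ordering $v_1\prec v_2\prec\dots\prec v_n$, and in which, if $c\ge1$, the vertices $v_1,v_2,v_3$ form a triangle. -/

import Mathlib

/-- `f` is a symmetric function of two positive real variables
(its values elsewhere play no role). -/
def SymmetricOnPos (f : ℝ → ℝ → ℝ) : Prop :=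
  ∀ x y : ℝ, 0 < x → 0 < y → f x y = f y x

/-- Escalating functions of two positive real variables. -/
structure IsEscalating (f : ℝ → ℝ → ℝ) : Prop where
  symm : SymmetricOnPos f
  le : ∀ x₁ y₁ x₂ y₂ : ℝ, 0 < y₁ → y₁ ≤ x₁ → 0 < y₂ → y₂ ≤ x₂ →
    f x₂ y₁ + f x₁ y₂ ≤ f x₁ x₂ + f y₁ y₂
  lt : ∀ x₁ y₁ x₂ y₂ : ℝ, 0 < y₁ → y₁ < x₁ → 0 < y₂ → y₂ < x₂ →
    f x₂ y₁ + f x₁ y₂ < f x₁ x₂ + f y₁ y₂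

/-- De-escalating functions of two positive real variables. -/
structure IsDeEscalating (f : ℝ → ℝ → ℝ) : Prop where
  symm : SymmetricOnPos f
  le : ∀ x₁ y₁ x₂ y₂ : ℝ, 0 < y₁ → y₁ ≤ x₁ → 0 < y₂ → y₂ ≤ x₂ →
    f x₁ x₂ + f y₁ y₂ ≤ f x₂ y₁ + f x₁ y₂
  lt : ∀ x₁ y₁ x₂ y₂ : ℝ, 0 < y₁ → y₁ < x₁ → 0 < y₂ → y₂ < x₂ →
    f x₁ x₂ + f y₁ y₂ < f x₂ y₁ + f x₁ y₂

open Classical in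
/-- The connectivity function `M_f(G)`: the sum over the edges `uv` of `G` of `f (d u) (d v)`.
To have a function of the unordered pair `uv` for every `f`, the summand is written as the mean of
`f (d u) (d v)` and `f (d v) (d u)`; for symmetric `f` these two numbers agree
(see `connectivity_eq_sum`). -/
noncomputable def connectivity {V : Type*} [Fintype V] (f : ℝ → ℝ → ℝ) (G : SimpleGraph V) : ℝ :=
  ∑ e ∈ G.edgeFinset,
    Sym2.lift ⟨fun u v => (f (G.degree u) (G.degree v) + f (G.degree v) (G.degree u)) / 2,
      fun _ _ => congrArg (fun t : ℝ => t / 2) (add_comm _ _)⟩ e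

open Classical in
/-- Sanity check: for a function that is symmetric on positive arguments, `connectivity` is the sum
of `f (d u) (d v)` over the edges `uv`, whatever orientation is used to read off `u` and `v`. -/
theorem connectivity_eq_sum {V : Type*} [Fintype V] (f : ℝ → ℝ → ℝ) (hf : SymmetricOnPos f)
    (G : SimpleGraph V) (a b : Sym2 V → V) (hab : ∀ e, s(a e, b e) = e) :
    connectivity f G = ∑ e ∈ G.edgeFinset, f (G.degree (a e)) (G.degree (b e)) := by
  unfold connectivity
  refine Finset.sum_congr rfl fun e he => ?_
  have hadj : G.Adj (a e) (b e) := by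
    have h1 : s(a e, b e) ∈ G.edgeSet := by
      rw [hab e]; exact SimpleGraph.mem_edgeFinset.1 he
    exact h1
  have ha : (0 : ℝ) < G.degree (a e) :=
    Nat.cast_pos.2 ((G.degree_pos_iff_exists_adj _).2 ⟨_, hadj⟩)
  have hb : (0 : ℝ) < G.degree (b e) :=
    Nat.cast_pos.2 ((G.degree_pos_iff_exists_adj _).2 ⟨_, hadj.symm⟩)
  conv_lhs => rw [← hab e]
  rw [Sym2.lift_mk]
  simp only [hf _ _ hb ha]
  ring

open Classical in
/-- A `c`-cyclic graph: a connected simple graph with `m = n + c - 1` edges on `n` vertices. -/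
def IsCyclicGraph {V : Type*} [Fintype V] (c : ℕ) (G : SimpleGraph V) : Prop :=
  G.Connected ∧ G.edgeFinset.card + 1 = Fintype.card V + c

open Classical in
/-- `Γ(π)`: the connected simple graphs with degree sequence `π = (d₁, …, dₙ)`. The vertices
`v₁, …, vₙ` are the elements of `Fin n` in their order, and `vᵢ` has degree `dᵢ`. -/
def GraphsWithDegrees {n : ℕ} (d : Fin n → ℕ) : Set (SimpleGraph (Fin n)) :=
  {G | G.Connected ∧ ∀ i, G.degree i = d i}

/-- `π = (d₁ ≥ d₂ ≥ … ≥ dₙ)` is the degree sequence of some `c`-cyclic graph. -/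
def IsCyclicDegreeSequence {n : ℕ} (c : ℕ) (d : Fin n → ℕ) : Prop :=
  Antitone d ∧ ∃ G ∈ GraphsWithDegrees d, IsCyclicGraph c G

open Classical in
/-- The ordering `σ 0 ≺ σ 1 ≺ … ≺ σ (n-1)` of the vertices makes the connected graph `G` a
BFS-graph, where `h v` is the distance from the first vertex `σ 0` to `v`. -/
structure IsBFSOrdering {V : Type*} [Fintype V] {n : ℕ} [NeZero n]
    (G : SimpleGraph V) (σ : Fin n ≃ V) : Prop where
  connected : G.Connected
  degree_anti : ∀ i j : Fin n, i ≤ j → G.degree (σ j) ≤ G.degree (σ i)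
  dist_mono : ∀ i j : Fin n, i ≤ j → G.dist (σ 0) (σ i) ≤ G.dist (σ 0) (σ j)
  children : ∀ u w v z : Fin n,
    G.Adj (σ u) (σ v) → ¬ G.Adj (σ w) (σ v) →
    G.Adj (σ w) (σ z) → ¬ G.Adj (σ u) (σ z) →
    G.dist (σ 0) (σ u) = G.dist (σ 0) (σ w) →
    G.dist (σ 0) (σ v) = G.dist (σ 0) (σ u) + 1 →
    G.dist (σ 0) (σ z) = G.dist (σ 0) (σ u) + 1 →
    u < w → v < z

/-- `v₁, v₂, v₃` exist and form a triangle of `G`. -/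
def FirstThreeFormTriangle {n : ℕ} (G : SimpleGraph (Fin n)) : Prop :=
  ∃ h : 3 ≤ n,
    G.Adj ⟨0, by omega⟩ ⟨1, by omega⟩ ∧
    G.Adj ⟨0, by omega⟩ ⟨2, by omega⟩ ∧
    G.Adj ⟨1, by omega⟩ ⟨2, by omega⟩

/-! Everything rests on one exchange: replace edges `uv`, `xy` by `uy`, `xv`, where `u < x` and `y <
v`. All degrees are kept, and since `u`, `y` have degrees at least those of `x`, `v`, an escalating
`f` does not lose. The sum of the products of endpoint indices grows by `(x - u) * (v - y) > 0`. So
a maximizer of `M_f` that also has the largest index sum admits no such exchange that keeps the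
graph connected (`SwitchOptimal`), and the rest uses only this property and the ordering of the
degrees.

If `i < j`, then `i` has at least as many private neighbours relative to `j` as `j` has relative to
`i` (`card_privateNeighbors_le`). This supplies the second edge of an exchange; what remains each
time is a path that survives the two deletions. The BFS conditions follow this way (`dist_mono`,
`children_lt`).

For the triangle, `v₁` is adjacent to the next three vertices, and `c ≥ 1` forces some vertex `b` to
have two smaller neighbours `a' < a`. With `a` least, the vertices up to `a` induce a tree.
Exchanges with the edge `ba` leave this tree almost no leaves (`eq_of_forall_adj_lt`), and a count
of parents contradicts `v₂`, `v₃` being nonadjacent. -/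

namespace SimpleGraph

/-! ### Edge switching. -/

section Switch

variable {V : Type*}

/-- The graph obtained from `G` by replacing the edges `uv`, `xy` with `uy`, `xv`. -/
def switch (G : SimpleGraph V) (u v x y : V) : SimpleGraph V :=
  fromEdgeSet ((G.edgeSet \ {s(u, v), s(x, y)}) ∪ {s(u, y), s(x, v)})

variable {G : SimpleGraph V} {u v x y : V}

theorem switch_adj (a b : V) : (G.switch u v x y).Adj a b ↔
    ((G.deleteEdges {s(u, v), s(x, y)}).Adj a b ∨ s(a, b) = s(u, y) ∨ s(a, b) = s(x, v)) ∧
      a ≠ b := by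
  simp only [switch, fromEdgeSet_adj, deleteEdges_adj, Set.mem_union, Set.mem_sdiff, mem_edgeSet,
    Set.mem_insert_iff, Set.mem_singleton_iff]

theorem deleteEdges_le_switch :
    G.deleteEdges {s(u, v), s(x, y)} ≤ G.switch u v x y := fun a b h =>
  (switch_adj a b).2 ⟨Or.inl h, h.ne⟩

theorem connected_of_adj_reachable {H : SimpleGraph V} (hG : G.Connected)
    (h : ∀ a b, G.Adj a b → H.Reachable a b) : H.Connected := by
  have := hG.nonempty
  refine ⟨fun a b => ?_⟩
  obtain ⟨p⟩ := hG.preconnected a b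
  induction p with
  | nil => exact Reachable.refl _
  | cons hab _ ih => exact (h _ _ hab).trans ih

/-- A surviving path joining `u` to `x`, or `y` to `v`, together with the two new edges, reconnects
the ends of both deleted edges. -/
theorem switch_connected (hG : G.Connected) (huy : u ≠ y) (hxv : x ≠ v)
    (h : (G.deleteEdges {s(u, v), s(x, y)}).Reachable u x ∨
      (G.deleteEdges {s(u, v), s(x, y)}).Reachable y v) : (G.switch u v x y).Connected := by
  have h1 : (G.switch u v x y).Reachable u y :=
    Adj.reachable ((switch_adj u y).2 ⟨Or.inr (Or.inl rfl), huy⟩)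
  have h2 : (G.switch u v x y).Reachable x v :=
    Adj.reachable ((switch_adj x v).2 ⟨Or.inr (Or.inr rfl), hxv⟩)
  have h3 : (G.switch u v x y).Reachable u v ∧ (G.switch u v x y).Reachable x y := by
    rcases h with h | h
    · have h := h.mono deleteEdges_le_switch
      exact ⟨h.trans h2, h.symm.trans h1⟩
    · have h := h.mono deleteEdges_le_switch
      exact ⟨h1.trans h, h2.trans h.symm⟩
  refine connected_of_adj_reachable hG fun a b hab => ?_
  by_cases hR : (G.deleteEdges {s(u, v), s(x, y)}).Adj a b
  · exact hR.reachable.mono deleteEdges_le_switch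
  · rw [deleteEdges_adj] at hR
    have hR : s(a, b) = s(u, v) ∨ s(a, b) = s(x, y) := by
      by_contra hc; exact hR ⟨hab, by simpa using hc⟩
    rcases hR with hR | hR <;> rcases Sym2.eq_iff.1 hR with ⟨rfl, rfl⟩ | ⟨rfl, rfl⟩
    · exact h3.1
    · exact h3.1.symm
    · exact h3.2
    · exact h3.2.symm

open Classical in
theorem sum_edgeFinset_switch [Fintype V] {M : Type*} [AddCommMonoid M] (g : Sym2 V → M)
    (huv : G.Adj u v) (hxy : G.Adj x y) (huy : ¬ G.Adj u y) (hxv : ¬ G.Adj x v)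
    (huy' : u ≠ y) (hxv' : x ≠ v) (hux : u ≠ x) :
    ∑ e ∈ (G.switch u v x y).edgeFinset, g e + (g s(u, v) + g s(x, y)) =
      ∑ e ∈ G.edgeFinset, g e + (g s(u, y) + g s(x, v)) := by
  have hne1 : s(u, v) ≠ s(x, y) := by simp [hux, huy']
  have hne2 : s(u, y) ≠ s(x, v) := by simp [hux, huv.ne]
  set E := (G.edgeFinset.erase s(u, v)).erase s(x, y) with hE
  have e1 : (G.switch u v x y).edgeFinset = insert s(u, y) (insert s(x, v) E) := by
    ext e
    induction e with
    | _ a b =>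
      simp only [mem_edgeFinset, mem_edgeSet, switch_adj, deleteEdges_adj, Finset.mem_insert, hE,
        Finset.mem_erase, Set.mem_insert_iff, Set.mem_singleton_iff]
      constructor
      · tauto
      · intro h
        refine ⟨by tauto, ?_⟩
        rintro rfl
        rcases h with h | h | h
        · grind [Sym2.eq_iff]
        · grind [Sym2.eq_iff]
        · exact G.irrefl h.2.2
  have n1 : s(x, v) ∉ E := by simp [hE, hxv]
  have n2 : s(u, y) ∉ insert s(x, v) E := by simp [hE, huy, hne2]
  have m1 : s(u, v) ∈ G.edgeFinset := by simpa using huv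
  have m2 : s(x, y) ∈ G.edgeFinset.erase s(u, v) := by simpa [hne1.symm] using hxy
  rw [e1, Finset.sum_insert n2, Finset.sum_insert n1, ← Finset.add_sum_erase _ g m1,
    ← Finset.add_sum_erase _ g m2]
  abel

open Classical in
theorem degree_eq_sum_edgeFinset [Fintype V] (H : SimpleGraph V) (w : V) :
    H.degree w = ∑ e ∈ H.edgeFinset, if w ∈ e then 1 else 0 := by
  rw [← card_incidenceFinset_eq_degree, incidenceFinset_eq_filter, Finset.card_filter]

open Classical in
theorem degree_switch [Fintype V]
    (huv : G.Adj u v) (hxy : G.Adj x y) (huy : ¬ G.Adj u y) (hxv : ¬ G.Adj x v)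
    (huy' : u ≠ y) (hxv' : x ≠ v) (hux : u ≠ x) (w : V) :
    (G.switch u v x y).degree w = G.degree w := by
  have key := sum_edgeFinset_switch (fun e => if w ∈ e then 1 else 0)
    huv hxy huy hxv huy' hxv' hux
  rw [← degree_eq_sum_edgeFinset, ← degree_eq_sum_edgeFinset] at key
  have h2 : ((if w ∈ s(u, v) then 1 else 0) + (if w ∈ s(x, y) then 1 else 0) : ℕ) =
      (if w ∈ s(u, y) then 1 else 0) + (if w ∈ s(x, v) then 1 else 0) := by
    have := huv.ne
    have := hxy.ne
    simp only [Sym2.mem_iff]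
    grind
  omega

end Switch

/-- No connected graph arises from `G` by replacing edges `uv`, `xy` with `uy`, `xv` where `u < x`
and `y < v`, at least as far as connectedness is witnessed by a path from `u` to `x` or from `y` to
`v` that avoids both deleted edges. -/
def SwitchOptimal {V : Type*} [LT V] (G : SimpleGraph V) : Prop :=
  ∀ u v x y, G.Adj u v → G.Adj x y → ¬ G.Adj u y → ¬ G.Adj x v → u ≠ y → x ≠ v → u < x → y < v →
    ¬ ((G.deleteEdges {s(u, v), s(x, y)}).Reachable u x ∨
      (G.deleteEdges {s(u, v), s(x, y)}).Reachable y v)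

end SimpleGraph

/-! ### Choice of the extremal graph. -/

open SimpleGraph

theorem IsDeEscalating.neg {f : ℝ → ℝ → ℝ} (hf : IsDeEscalating f) :
    IsEscalating fun x y => -f x y where
  symm x y hx hy := congrArg Neg.neg (hf.symm x y hx hy)
  le x₁ y₁ x₂ y₂ h1 h2 h3 h4 := by linarith [hf.le x₁ y₁ x₂ y₂ h1 h2 h3 h4]
  lt x₁ y₁ x₂ y₂ h1 h2 h3 h4 := by linarith [hf.lt x₁ y₁ x₂ y₂ h1 h2 h3 h4]

theorem connectivity_neg {V : Type*} [Fintype V] (f : ℝ → ℝ → ℝ) (G : SimpleGraph V) :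
    connectivity (fun x y => -f x y) G = -connectivity f G := by
  unfold connectivity
  rw [← Finset.sum_neg_distrib]
  refine Finset.sum_congr rfl fun e _ => ?_
  induction e with
  | _ a b => simp only [Sym2.lift_mk]; ring

open Classical in
theorem exists_isMaxOn_connectivity_switchOptimal {n : ℕ} {d : Fin n → ℕ} (hd : Antitone d)
    (hne : (GraphsWithDegrees d).Nonempty) {f : ℝ → ℝ → ℝ} (hf : IsEscalating f) :
    ∃ G ∈ GraphsWithDegrees d, IsMaxOn (connectivity f) (GraphsWithDegrees d) G ∧
      G.SwitchOptimal := by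
  -- Tie-breaker: an exchange between vertices of equal degree may leave `M_f` unchanged, but it
  -- strictly increases `S`.
  let S : SimpleGraph (Fin n) → ℝ := fun G =>
    ∑ e ∈ G.edgeFinset, Sym2.lift ⟨fun u v : Fin n => ((u : ℝ) * (v : ℝ)), fun _ _ => mul_comm _ _⟩ e
  obtain ⟨G₀, hG₀, hmax₀⟩ := Set.exists_max_image (GraphsWithDegrees d) (connectivity f)
    (Set.toFinite _) hne
  let T := {G | G ∈ GraphsWithDegrees d ∧ connectivity f G₀ ≤ connectivity f G}
  obtain ⟨G, ⟨hG, hGf⟩, hmax⟩ := Set.exists_max_image T S (Set.toFinite _) ⟨G₀, hG₀, le_rfl⟩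
  refine ⟨G, hG, fun H hH => (hmax₀ H hH).trans hGf, ?_⟩
  intro u v x y huv hxy huy hxv huy' hxv' hux hyv hR
  have hdeg := degree_switch huv hxy huy hxv huy' hxv' hux.ne
  have hG' : G.switch u v x y ∈ GraphsWithDegrees d :=
    ⟨switch_connected hG.1 huy' hxv' hR, fun i => by rw [hdeg, hG.2]⟩
  have hpos : ∀ {a b}, G.Adj a b → (0 : ℝ) < G.degree a := fun h =>
    Nat.cast_pos.2 ((G.degree_pos_iff_exists_adj _).2 ⟨_, h⟩)
  have hmono : ∀ {a b}, a ≤ b → (G.degree b : ℝ) ≤ G.degree a := fun h => by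
    rw [hG.2, hG.2]; exact_mod_cast hd h
  have hu := hpos huv
  have hv := hpos huv.symm
  have hx := hpos hxy
  have hy := hpos hxy.symm
  have h1 : connectivity f G ≤ connectivity f (G.switch u v x y) := by
    let g : Sym2 (Fin n) → ℝ :=
      Sym2.lift ⟨fun u v => (f (G.degree u) (G.degree v) + f (G.degree v) (G.degree u)) / 2,
        fun _ _ => congrArg (fun t : ℝ => t / 2) (add_comm _ _)⟩
    have key := sum_edgeFinset_switch g huv hxy huy hxv huy' hxv' hux.ne
    have e1 : connectivity f (G.switch u v x y) =
        ∑ e ∈ (G.switch u v x y).edgeFinset, g e := by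
      refine Finset.sum_congr rfl fun e _ => ?_
      induction e with
      | _ a b => simp only [g, Sym2.lift_mk, hdeg]
    rw [← e1] at key
    change connectivity f (G.switch u v x y) + _ = connectivity f G + _ at key
    simp only [g, Sym2.lift_mk] at key
    have := hf.le _ _ _ _ hx (hmono hux.le) hv (hmono hyv.le)
    have s1 := hf.symm _ _ hu hv
    have s2 := hf.symm _ _ hx hy
    have s3 := hf.symm _ _ hu hy
    have s4 := hf.symm _ _ hx hv
    linarith
  have h2 := hmax _ ⟨hG', hGf.trans h1⟩
  have key := sum_edgeFinset_switch
    (Sym2.lift ⟨fun u v : Fin n => ((u : ℝ) * (v : ℝ)), fun _ _ => mul_comm _ _⟩)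
    huv hxy huy hxv huy' hxv' hux.ne
  change S (G.switch u v x y) + _ = S G + _ at key
  simp only [Sym2.lift_mk] at key
  have a1 : (0 : ℝ) < (x : ℝ) - u := sub_pos.2 (by exact_mod_cast hux)
  have a2 : (0 : ℝ) < (v : ℝ) - y := sub_pos.2 (by exact_mod_cast hyv)
  have := mul_pos a1 a2
  nlinarith
-- Distances and private neighbours.
namespace SimpleGraph

variable {V : Type*} {G : SimpleGraph V}

theorem Connected.exists_adj_dist_add_one (hG : G.Connected) {r x : V} (hx : x ≠ r) :
    ∃ y, G.Adj x y ∧ G.dist r y + 1 = G.dist r x := by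
  obtain ⟨p, hp⟩ := hG.exists_walk_length_eq_dist x r
  cases p with
  | nil => exact absurd rfl hx
  | cons h q =>
    rename_i y
    refine ⟨y, h, ?_⟩
    have h1 := dist_le q
    have h2 := hG.dist_triangle (u := r) (v := y) (w := x)
    rw [dist_comm] at h1
    rw [dist_comm (u := x), Walk.length_cons] at hp
    have h3 := dist_eq_one_iff_adj.2 h.symm
    omega

theorem Connected.dist_le_dist_add_one (hG : G.Connected) (r : V) {x y : V} (h : G.Adj x y) :
    G.dist r y ≤ G.dist r x + 1 := by
  have h2 := hG.dist_triangle (u := r) (v := x) (w := y)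
  rwa [dist_eq_one_iff_adj.2 h] at h2

/-- If every vertex satisfying `P` other than `t` has a neighbour that satisfies `P` and is smaller
with respect to `μ`, then `t` can be reached from all of them. -/
theorem reachable_of_descent {H : SimpleGraph V} {t : V} (μ : V → ℕ) (P : V → Prop)
    (h : ∀ y, P y → y ≠ t → ∃ z, H.Adj y z ∧ μ z < μ y ∧ P z) {y : V} (hy : P y) :
    H.Reachable y t := by
  induction hk : μ y using Nat.strong_induction_on generalizing y with
  | _ k ih =>
    by_cases hyt : y = t
    · exact hyt ▸ Reachable.refl _
    · obtain ⟨z, hz, hlt, hPz⟩ := h y hy hyt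
      exact hz.reachable.trans (ih _ (hk ▸ hlt) hPz rfl)

theorem deleteEdges_pair_adj {u v x y a b : V} :
    (G.deleteEdges {s(u, v), s(x, y)}).Adj a b ↔
      G.Adj a b ∧ ¬ (a = u ∧ b = v ∨ a = v ∧ b = u) ∧ ¬ (a = x ∧ b = y ∨ a = y ∧ b = x) := by
  simp [deleteEdges_adj]

open Classical in
/-- The neighbours of `u` that are neither equal nor adjacent to `w`. -/
noncomputable def privateNeighbors [Fintype V] (G : SimpleGraph V) (u w : V) : Finset V :=
  {x | G.Adj u x ∧ x ≠ w ∧ ¬ G.Adj w x}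

theorem mem_privateNeighbors [Fintype V] {u w x : V} :
    x ∈ G.privateNeighbors u w ↔ G.Adj u x ∧ x ≠ w ∧ ¬ G.Adj w x := by
  simp [privateNeighbors]

-- The common neighbours cancel, and an edge `uw` counts once on each side.
open Classical in
theorem card_privateNeighbors_le [Fintype V] {u w : V} (h : G.degree w ≤ G.degree u) :
    (G.privateNeighbors w u).card ≤ (G.privateNeighbors u w).card := by
  have key : ∀ a b : V, G.privateNeighbors a b =
      (G.neighborFinset a).erase b \ (G.neighborFinset b).erase a := by
    intro a b
    ext x
    simp only [mem_privateNeighbors, Finset.mem_sdiff, Finset.mem_erase, mem_neighborFinset]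
    have : G.Adj a x → x ≠ a := fun h => h.ne'
    tauto
  rw [key, key, Finset.card_sdiff_le_card_sdiff_iff]
  by_cases hadj : G.Adj u w
  · rw [Finset.card_erase_of_mem (by simpa using hadj.symm),
      Finset.card_erase_of_mem (by simpa using hadj), card_neighborFinset_eq_degree,
      card_neighborFinset_eq_degree]
    omega
  · rw [Finset.erase_eq_of_notMem (by simpa [adj_comm] using hadj),
      Finset.erase_eq_of_notMem (by simpa using hadj), card_neighborFinset_eq_degree,
      card_neighborFinset_eq_degree]
    exact h

/-! ### The BFS conditions. -/

section Order

variable {n : ℕ} [NeZero n] {G : SimpleGraph (Fin n)}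

-- If `i < j` but `i` is farther from the root, let `p` be a parent of `j`. Exchanging `iq`, `jp`
-- for `ip`, `jq` is then possible for a suitable private neighbour `q` of `i`; which one depends on
-- whether `j` lies on a geodesic from the root to `i`.
open Classical in
theorem SwitchOptimal.dist_mono (hG : G.Connected) (hdeg : Antitone fun i => G.degree i)
    (hopt : G.SwitchOptimal) : Monotone fun i => G.dist 0 i := by
  suffices H : ∀ k, ∀ j, G.dist 0 j = k → ∀ i, i < j → G.dist 0 i ≤ G.dist 0 j from
    monotone_iff_forall_lt.2 fun i j hij => H _ j rfl i hij
  intro k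
  induction k using Nat.strong_induction_on with
  | _ k ih =>
  intro j hjk i hij
  by_contra! hlt
  have hj0 : j ≠ 0 := by rintro rfl; simp at hij
  obtain ⟨p, hjp, hp⟩ := hG.exists_adj_dist_add_one hj0
  have hip : ¬ G.Adj i p := fun h => by
    have := hG.dist_le_dist_add_one 0 h.symm; omega
  have hne_ip : i ≠ p := by rintro rfl; omega
  have tri : ∀ a b, G.dist 0 a ≤ G.dist 0 b + G.dist a b := fun a b => by
    have := hG.dist_triangle (u := 0) (v := b) (w := a)
    rwa [dist_comm (u := b)] at this
  have hforbid : ∀ q ∈ G.privateNeighbors i j,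
      ¬ ((G.deleteEdges {s(i, q), s(j, p)}).Reachable i j ∨
        (G.deleteEdges {s(i, q), s(j, p)}).Reachable p q) := by
    intro q hq
    obtain ⟨hiq, hqj, hjq⟩ := mem_privateNeighbors.1 hq
    -- `q` is farther from the root than `p`, so the induction hypothesis at the level of `p`
    -- excludes `q < p`.
    have hpq : p < q := by
      have := hG.dist_le_dist_add_one 0 hiq.symm
      refine lt_of_le_of_ne (not_lt.1 fun hqp => ?_) ?_
      · have := ih _ (by omega) p rfl q hqp
        omega
      · rintro rfl; omega
    exact hopt i q j p hiq hjp hip hjq hne_ip hqj.symm hij hpq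
  have hp_mem : p ∈ G.privateNeighbors j i := mem_privateNeighbors.2 ⟨hjp, hne_ip.symm, hip⟩
  have hcard := card_privateNeighbors_le (hdeg hij.le)
  obtain ⟨q₁, hq₁⟩ : (G.privateNeighbors i j).Nonempty :=
    Finset.card_pos.1 (lt_of_lt_of_le (Finset.card_pos.2 ⟨p, hp_mem⟩) hcard)
  -- If `j` is on a geodesic from `0` to `i`, the surviving path runs from `i` to `j` through `s`,
  -- so `q` must differ from `s`.
  by_cases hgeo : G.dist i j + G.dist 0 j = G.dist 0 i
  · obtain ⟨s, his, hs⟩ := hG.exists_adj_dist_add_one (r := j) hij.ne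
    rw [dist_comm, dist_comm (u := j)] at hs
    obtain ⟨q, hq, hqs⟩ : ∃ q ∈ G.privateNeighbors i j, q ≠ s := by
      by_cases hsj : s = j ∨ G.Adj j s
      · refine ⟨q₁, hq₁, ?_⟩
        rintro rfl
        have := (mem_privateNeighbors.1 hq₁).2
        tauto
      · push Not at hsj
        have h2 : 1 < G.dist s j := hG.one_lt_dist_of_ne_of_not_adj hsj.1 fun h => hsj.2 h.symm
        obtain ⟨t, hjt, ht⟩ := hG.exists_adj_dist_add_one (r := i) hij.ne'
        have ht_mem : t ∈ G.privateNeighbors j i := by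
          refine mem_privateNeighbors.2 ⟨hjt, ?_, fun h => ?_⟩
          · rintro rfl
            simp only [dist_self] at ht
            omega
          · have := dist_eq_one_iff_adj.2 h
            omega
        -- Here `t` is a step from `j` towards `i` and `p` a step towards the root; equality would
        -- shorten the geodesic.
        have htp : t ≠ p := by
          rintro rfl
          have := tri i t
          omega
        have : 1 < (G.privateNeighbors i j).card :=
          lt_of_lt_of_le (Finset.one_lt_card.2 ⟨t, ht_mem, p, hp_mem, htp⟩) hcard
        exact Finset.exists_mem_ne this s
    refine hforbid q hq (Or.inl ?_)
    obtain ⟨hiq, hqj, hjq⟩ := mem_privateNeighbors.1 hq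
    have his' : (G.deleteEdges {s(i, q), s(j, p)}).Adj i s := by
      refine deleteEdges_pair_adj.2 ⟨his, ?_, ?_⟩
      · rintro (⟨-, h⟩ | ⟨h, -⟩)
        · exact hqs h.symm
        · exact hiq.ne h
      · rintro (⟨h, -⟩ | ⟨h, -⟩)
        · exact hij.ne h
        · exact hne_ip h
    refine his'.reachable.trans (reachable_of_descent (fun y => G.dist y j)
      (fun y => G.dist y j + G.dist 0 j = G.dist 0 y ∧ G.dist 0 y < G.dist 0 i) ?_ ?_)
    · rintro y ⟨hy1, hy2⟩ hyj
      obtain ⟨z, hyz, hz⟩ := hG.exists_adj_dist_add_one (r := j) hyj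
      rw [dist_comm, dist_comm (u := j)] at hz
      have t1 := tri z j
      have t2 := hG.dist_le_dist_add_one 0 hyz.symm
      refine ⟨z, deleteEdges_pair_adj.2 ⟨hyz, ?_, ?_⟩, by omega, by omega, by omega⟩
      · rintro (⟨rfl, -⟩ | ⟨-, rfl⟩) <;> omega
      · rintro (⟨rfl, -⟩ | ⟨rfl, -⟩)
        · exact hyj rfl
        · omega
    · have t1 := tri s j
      have t2 := hG.dist_le_dist_add_one 0 his.symm
      exact ⟨by omega, by omega⟩
  · have hi0 : i ≠ 0 := by rintro rfl; simp at hlt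
    obtain ⟨q, hiq, hq⟩ := hG.exists_adj_dist_add_one hi0
    have hqj : q ≠ j := by
      rintro rfl
      have := dist_eq_one_iff_adj.2 hiq
      omega
    by_cases hjq : G.Adj j q
    · have hiqj : G.dist i j ≤ 2 := by
        have := hG.dist_triangle (u := i) (v := q) (w := j)
        rwa [dist_eq_one_iff_adj.2 hiq, dist_eq_one_iff_adj.2 hjq.symm] at this
      have h1 := hG.dist_le_dist_add_one 0 hjq
      have h2 := tri i j
      have hqp : q ≠ p := by rintro rfl; omega
      obtain ⟨hiq₁, hq₁j, hjq₁⟩ := mem_privateNeighbors.1 hq₁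
      refine hforbid q₁ hq₁ (Or.inl ?_)
      have a1 : (G.deleteEdges {s(i, q₁), s(j, p)}).Adj i q := by
        refine deleteEdges_pair_adj.2 ⟨hiq, ?_, ?_⟩
        · rintro (⟨-, rfl⟩ | ⟨rfl, -⟩)
          · exact hjq₁ hjq
          · exact hiq₁.ne rfl
        · rintro (⟨h, -⟩ | ⟨h, -⟩)
          · exact hij.ne h
          · exact hne_ip h
      have a2 : (G.deleteEdges {s(i, q₁), s(j, p)}).Adj q j := by
        refine deleteEdges_pair_adj.2 ⟨hjq.symm, ?_, ?_⟩
        · rintro (⟨-, h⟩ | ⟨-, h⟩)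
          · exact hq₁j h.symm
          · exact hij.ne' h
        · rintro (⟨h, -⟩ | ⟨h, -⟩)
          · exact hqj h
          · exact hqp h
      exact a1.reachable.trans a2.reachable
    · refine hforbid q (mem_privateNeighbors.2 ⟨hiq, hqj, hjq⟩) (Or.inr ?_)
      -- Descent to the root from `p` and from `q` avoids both `i` and `j`, hence both deleted
      -- edges; `j` is avoided because it is on no geodesic to `i`.
      have key : ∀ y, ((G.dist i y + G.dist 0 y = G.dist 0 i ∧ G.dist 0 y < G.dist 0 i) ∨
          G.dist 0 y < G.dist 0 j) → (G.deleteEdges {s(i, q), s(j, p)}).Reachable y 0 := by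
        intro y hy
        refine reachable_of_descent (fun y => G.dist 0 y)
          (fun y => (G.dist i y + G.dist 0 y = G.dist 0 i ∧ G.dist 0 y < G.dist 0 i) ∨
            G.dist 0 y < G.dist 0 j) ?_ hy
        intro y hy hy0
        obtain ⟨z, hyz, hz⟩ := hG.exists_adj_dist_add_one hy0
        have hz' : (G.dist i z + G.dist 0 z = G.dist 0 i ∧ G.dist 0 z < G.dist 0 i) ∨
            G.dist 0 z < G.dist 0 j := by
          rcases hy with hy | hy
          · have t1 := hG.dist_le_dist_add_one i hyz
            have t2 := tri i z
            exact Or.inl ⟨by omega, by omega⟩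
          · exact Or.inr (by omega)
        have ne : ∀ w, ((G.dist i w + G.dist 0 w = G.dist 0 i ∧ G.dist 0 w < G.dist 0 i) ∨
            G.dist 0 w < G.dist 0 j) → w ≠ i ∧ w ≠ j := by
          rintro w hw
          constructor
          · rintro rfl; omega
          · rintro rfl; omega
        have ney := ne y hy
        have nez := ne z hz'
        refine ⟨z, deleteEdges_pair_adj.2 ⟨hyz, ?_, ?_⟩, by omega, hz'⟩
        · rintro (⟨h, -⟩ | ⟨-, h⟩)
          · exact ney.1 h
          · exact nez.1 h
        · rintro (⟨h, -⟩ | ⟨-, h⟩)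
          · exact ney.2 h
          · exact nez.2 h
      refine (key p (Or.inr (by omega))).trans (key q (Or.inl ⟨?_, by omega⟩)).symm
      rw [dist_eq_one_iff_adj.2 hiq]
      omega

/-- Geodesics from `u` and `w` to the root never use the lower vertices `v`, `z`, so the exchange
would keep the graph connected. -/
theorem SwitchOptimal.children_lt (hG : G.Connected) (hopt : G.SwitchOptimal) {u w v z : Fin n}
    (huv : G.Adj u v) (hwv : ¬ G.Adj w v) (hwz : G.Adj w z) (huz : ¬ G.Adj u z)
    (huw : G.dist 0 u = G.dist 0 w) (hv : G.dist 0 v = G.dist 0 u + 1)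
    (hz : G.dist 0 z = G.dist 0 u + 1) (hlt : u < w) : v < z := by
  by_contra! hzv
  have hne : z ≠ v := by rintro rfl; exact hwv hwz
  have hreach : ∀ y, G.dist 0 y ≤ G.dist 0 u →
      (G.deleteEdges {s(u, v), s(w, z)}).Reachable y 0 := by
    intro y hy
    refine reachable_of_descent (fun y => G.dist 0 y) (fun y => G.dist 0 y ≤ G.dist 0 u) ?_ hy
    intro y hy hy0
    obtain ⟨x, hyx, hx⟩ := hG.exists_adj_dist_add_one hy0
    refine ⟨x, deleteEdges_pair_adj.2 ⟨hyx, ?_, ?_⟩, by omega, by omega⟩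
    · rintro (⟨-, rfl⟩ | ⟨rfl, -⟩) <;> omega
    · rintro (⟨-, rfl⟩ | ⟨rfl, -⟩) <;> omega
  refine hopt u v w z huv hwz huz hwv ?_ ?_ hlt (lt_of_le_of_ne hzv hne)
    (Or.inl ((hreach u le_rfl).trans (hreach w huw.ge).symm))
  · rintro rfl; omega
  · rintro rfl; omega

end Order

end SimpleGraph
-- The triangle.
namespace SimpleGraph

section Triangle

variable {n : ℕ} [NeZero n] {G : SimpleGraph (Fin n)}

-- Pigeonhole: send each edge to its larger endpoint, which is never `0`.
open Classical in
theorem exists_two_smaller_adj (h : n ≤ G.edgeFinset.card) :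
    ∃ a' a b, a' < a ∧ a < b ∧ G.Adj b a' ∧ G.Adj b a := by
  have hcard : (Finset.univ.erase (0 : Fin n)).card < G.edgeFinset.card := by
    rw [Finset.card_erase_of_mem (Finset.mem_univ _), Finset.card_univ, Fintype.card_fin]
    have := NeZero.pos n
    omega
  have hform : ∀ e ∈ G.edgeFinset, ∃ a, a < e.sup ∧ e = s(a, e.sup) ∧ G.Adj e.sup a := by
    intro e he
    induction e with
    | _ a b =>
      have hab : G.Adj a b := by simpa using he
      rcases lt_or_gt_of_ne hab.ne with h | h
      · exact ⟨a, by simpa using h, by simp [h.le], by simpa [h.le] using hab.symm⟩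
      · exact ⟨b, by simpa using h, by simp [h.le, Sym2.eq_swap], by simpa [h.le] using hab⟩
  obtain ⟨e, he, e', he', hne, heq⟩ := Finset.exists_ne_map_eq_of_card_lt_of_maps_to hcard
    (f := Sym2.sup) fun e he => by
      obtain ⟨a, ha, -⟩ := hform e he
      simpa using (lt_of_le_of_lt (Fin.zero_le a) ha).ne'
  obtain ⟨a, ha, hea, hadj⟩ := hform e he
  obtain ⟨a', ha', hea', hadj'⟩ := hform e' he'
  rw [← heq] at ha' hea' hadj'
  have haa : a ≠ a' := by rintro rfl; exact hne (hea.trans hea'.symm)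
  rcases lt_or_gt_of_ne haa with h | h
  · exact ⟨a, a', _, h, ha', hadj, hadj'⟩
  · exact ⟨a', a, _, h, ha, hadj', hadj⟩

theorem exists_smaller_adj (hG : G.Connected) (hmono : Monotone fun i => G.dist 0 i) {x : Fin n}
    (hx : x ≠ 0) : ∃ y, y < x ∧ G.Adj x y := by
  obtain ⟨y, hxy, hy⟩ := hG.exists_adj_dist_add_one hx
  refine ⟨y, not_le.1 fun h => ?_, hxy⟩
  have : G.dist 0 x ≤ G.dist 0 y := hmono h
  omega

theorem zero_adj_of_le (hG : G.Connected) (hmono : Monotone fun i => G.dist 0 i) {i j : Fin n}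
    (hi : i ≠ 0) (hij : i ≤ j) (hj : G.Adj 0 j) : G.Adj 0 i := by
  rw [← dist_eq_one_iff_adj] at hj ⊢
  have : G.dist 0 i ≤ G.dist 0 j := hmono hij
  have := hG.pos_dist_of_ne hi.symm
  omega

open Classical in
theorem zero_adj_of_le_degree (hG : G.Connected) (hmono : Monotone fun i => G.dist 0 i) {i : Fin n}
    (hi : i ≠ 0) (hdeg : (i : ℕ) ≤ G.degree 0) : G.Adj 0 i := by
  by_contra hadj
  have hsub : G.neighborFinset 0 ⊆ Finset.Ioo 0 i := by
    intro j hj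
    rw [mem_neighborFinset] at hj
    rw [Finset.mem_Ioo]
    exact ⟨lt_of_le_of_ne (Fin.zero_le j) hj.ne,
      not_le.1 fun h => hadj (zero_adj_of_le hG hmono hi h hj)⟩
  have := Finset.card_le_card hsub
  rw [card_neighborFinset_eq_degree, Fin.card_Ioo, Fin.val_zero] at this
  have : (i : ℕ) ≠ 0 := fun h => hi (Fin.ext (by simpa using h))
  omega

/-- `a` is smallest possible as the larger one of two smaller neighbours of some vertex. -/
def IsLeastSecondNeighbor (G : SimpleGraph (Fin n)) (a : Fin n) : Prop :=
  ∀ a₁ a₂ w, a₁ < a₂ → a₂ < w → G.Adj w a₁ → G.Adj w a₂ → a ≤ a₂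

theorem IsLeastSecondNeighbor.eq_of_adj {a x y z : Fin n} (ha : G.IsLeastSecondNeighbor a)
    (hx : x ≤ a) (hy : y < x) (hz : z < x) (hxy : G.Adj x y) (hxz : G.Adj x z) : y = z := by
  by_contra hne
  rcases lt_or_gt_of_ne hne with h | h
  · exact absurd (ha y z x h hz hxy hxz) (not_le.2 (hz.trans_le hx))
  · exact absurd (ha z y x h hy hxz hxy) (not_le.2 (hy.trans_le hx))

/-- Otherwise `uv`, `ba` could be exchanged for `ua`, `bv`: descending below `a` joins `u` to `a'`,
and `a'b` survives. -/
theorem SwitchOptimal.eq_or_adj (hG : G.Connected) (hmono : Monotone fun i => G.dist 0 i)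
    (hopt : G.SwitchOptimal) {a' a b u v : Fin n} (ha' : a' < a) (hab : a < b) (hba' : G.Adj b a')
    (hba : G.Adj b a) (hu : u < a) (hua : ¬ G.Adj u a) (huv : G.Adj u v) (hv : a < v) :
    v = b ∨ G.Adj b v := by
  by_contra! hc
  have hreach : ∀ y, y < a → (G.deleteEdges {s(u, v), s(b, a)}).Reachable y 0 := by
    intro y hy
    refine reachable_of_descent (fun y : Fin n => (y : ℕ)) (fun y => y < a) ?_ hy
    intro y hy hy0
    obtain ⟨z, hzy, hyz⟩ := exists_smaller_adj hG hmono hy0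
    have hz := hzy.trans hy
    refine ⟨z, deleteEdges_pair_adj.2 ⟨hyz, ?_, ?_⟩, hzy, hz⟩
    · rintro (⟨-, rfl⟩ | ⟨rfl, -⟩)
      · exact lt_asymm hz hv
      · exact lt_asymm hy hv
    · rintro (⟨-, rfl⟩ | ⟨rfl, -⟩)
      · exact lt_irrefl _ hz
      · exact lt_irrefl _ hy
  refine hopt u v b a huv hba hua hc.2 hu.ne hc.1.symm (hu.trans hab) hv (Or.inl ?_)
  refine (hreach u hu).trans ((hreach a' ha').symm.trans (Adj.reachable ?_))
  refine Adj.symm (deleteEdges_pair_adj.2 ⟨hba', ?_, ?_⟩)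
  · rintro (⟨h, -⟩ | ⟨h, -⟩)
    · exact (hu.trans hab).ne' h
    · exact hc.1 h.symm
  · rintro (⟨-, h⟩ | ⟨h, -⟩)
    · exact ha'.ne h
    · exact hab.ne' h

-- Such a `u` is a leaf of the tree on the vertices up to `a`. By `eq_or_adj` its only possible
-- private neighbour relative to `b` is its parent, so comparing degrees leaves `b` only the private
-- neighbour `a`. If `u ≠ a'`, then `a'` would be the parent of `u`, yet it is adjacent to `b`.
open Classical in
theorem SwitchOptimal.eq_of_forall_adj_lt (hG : G.Connected)
    (hmono : Monotone fun i => G.dist 0 i) (hdeg : Antitone fun i => G.degree i)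
    (hopt : G.SwitchOptimal) {a' a b u : Fin n} (hmin : G.IsLeastSecondNeighbor a)
    (ha' : a' < a) (hab : a < b) (hba' : G.Adj b a')
    (hba : G.Adj b a) (hu : u < a) (hua : ¬ G.Adj u a)
    (hlarge : ∀ v, G.Adj u v → u < v → a < v) :
    u = a' ∧ ∀ x, G.Adj b x → x ≠ a → x ≠ u → G.Adj u x := by
  have hsmall : ∀ x ∈ G.privateNeighbors u b, x < u := by
    intro x hx
    obtain ⟨hux, hxb, hbx⟩ := mem_privateNeighbors.1 hx
    refine lt_of_le_of_ne (not_lt.1 fun h => ?_) hux.ne'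
    rcases hopt.eq_or_adj hG hmono ha' hab hba' hba hu hua hux (hlarge x hux h) with h | h
    · exact hxb h
    · exact hbx h
  have hle : (G.privateNeighbors u b).card ≤ 1 := Finset.card_le_one.2 fun x hx y hy =>
    hmin.eq_of_adj hu.le (hsmall x hx) (hsmall y hy) (mem_privateNeighbors.1 hx).1
      (mem_privateNeighbors.1 hy).1
  have hcard := card_privateNeighbors_le (hdeg (hu.trans hab).le)
  have ha_mem : a ∈ G.privateNeighbors b u := mem_privateNeighbors.2 ⟨hba, hu.ne', hua⟩
  have hall : ∀ x, G.Adj b x → x ≠ a → x ≠ u → G.Adj u x := by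
    intro x hbx hxa hxu
    by_contra hux
    exact hxa (Finset.card_le_one.1 (hcard.trans hle) x
      (mem_privateNeighbors.2 ⟨hbx, hxu, hux⟩) a ha_mem)
  refine ⟨?_, hall⟩
  by_contra hne
  have hua' := hall a' hba' ha'.ne (Ne.symm hne)
  have ha'u : a' < u := lt_of_le_of_ne
    (not_lt.1 fun h => lt_asymm ha' (hlarge a' hua' h)) (Ne.symm hne)
  obtain ⟨x, hx⟩ : (G.privateNeighbors u b).Nonempty :=
    Finset.card_pos.1 (lt_of_lt_of_le (Finset.card_pos.2 ⟨a, ha_mem⟩) hcard)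
  have hxa' := hmin.eq_of_adj hu.le (hsmall x hx) ha'u (mem_privateNeighbors.1 hx).1 hua'
  exact (mem_privateNeighbors.1 hx).2.2 (hxa' ▸ hba')

open Classical in
theorem SwitchOptimal.second_adj_third (hG : G.Connected) (hdeg : Antitone fun i => G.degree i)
    (hopt : G.SwitchOptimal) (h3 : 3 ≤ G.degree 0) (hedge : n ≤ G.edgeFinset.card) {i j : Fin n}
    (hi : (i : ℕ) = 1) (hj : (j : ℕ) = 2) : G.Adj i j := by
  have hmono := hopt.dist_mono hG hdeg
  have hn : 3 < n := by
    have := G.degree_lt_card_verts 0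
    rw [Fintype.card_fin] at this
    omega
  obtain ⟨k, hk⟩ : ∃ k : Fin n, (k : ℕ) = 3 := ⟨⟨3, hn⟩, rfl⟩
  have hz : ((0 : Fin n) : ℕ) = 0 := Fin.val_zero n
  have hne : ∀ {x y : Fin n}, (x : ℕ) ≠ y → x ≠ y := fun h e => h (congrArg _ e)
  have hlt : ∀ {x y : Fin n}, x < y ↔ (x : ℕ) < y := Fin.lt_def
  have hval : ∀ {x y : Fin n}, x ≠ y → (x : ℕ) ≠ y := fun h e => h (Fin.ext e)
  have h0i : G.Adj 0 i := zero_adj_of_le_degree hG hmono (hne (by omega)) (by omega)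
  have h0j : G.Adj 0 j := zero_adj_of_le_degree hG hmono (hne (by omega)) (by omega)
  have h0k : G.Adj 0 k := zero_adj_of_le_degree hG hmono (hne (by omega)) (by omega)
  by_contra hij
  obtain ⟨a, ⟨a', b, ha', hab, hba', hba⟩, hmin'⟩ := WellFounded.has_min
    (wellFounded_lt (α := Fin n))
    {a | ∃ a' b, a' < a ∧ a < b ∧ G.Adj b a' ∧ G.Adj b a} (by
      obtain ⟨a', a, b, h⟩ := exists_two_smaller_adj hedge
      exact ⟨a, a', b, h⟩)
  have hmin : G.IsLeastSecondNeighbor a := fun a₁ a₂ w h1 h2 h3 h4 =>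
    not_lt.1 (hmin' a₂ ⟨a₁, w, h1, h2, h3, h4⟩)
  have hval_a' := hlt.1 ha'
  have hval_b := hlt.1 hab
  obtain ha1 | ha2 | ha3 : (a : ℕ) = 1 ∨ (a : ℕ) = 2 ∨ 3 ≤ (a : ℕ) := by omega
  -- Least index 1: `b` is adjacent to `0`, and the path `j`, `0`, `b` survives the exchange.
  · obtain rfl : a = i := Fin.ext (by omega)
    obtain rfl : a' = 0 := Fin.ext (by omega)
    have hbj : b ≠ j := by rintro rfl; exact hij hba.symm
    have := hval hbj
    obtain ⟨y, hy⟩ : (G.privateNeighbors j b).Nonempty := by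
      refine Finset.card_pos.1 (lt_of_lt_of_le (Finset.card_pos.2 ⟨a, ?_⟩)
        (card_privateNeighbors_le (hdeg (hlt.2 (by omega) : j < b).le)))
      exact mem_privateNeighbors.2 ⟨hba, hne (by omega), fun h => hij h.symm⟩
    obtain ⟨hjy, hyb, hby⟩ := mem_privateNeighbors.1 hy
    have hy0 : y ≠ 0 := by rintro rfl; exact hby hba'
    have hya : y ≠ a := by rintro rfl; exact hij hjy.symm
    have := hval hy0
    have := hval hya
    refine hopt j y b a hjy hba (fun h => hij h.symm) hby (hne (by omega)) hyb.symm
      (hlt.2 (by omega)) (hlt.2 (by omega)) (Or.inl ?_)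
    have e1 : (G.deleteEdges {s(j, y), s(b, a)}).Adj j 0 :=
      deleteEdges_pair_adj.2 ⟨h0j.symm, by grind, by grind⟩
    have e2 : (G.deleteEdges {s(j, y), s(b, a)}).Adj 0 b :=
      deleteEdges_pair_adj.2 ⟨hba'.symm, by grind, by grind⟩
    exact e1.reachable.trans e2.reachable
  -- Least index 2: `i` is a leaf, so `a' = i`. The exchange is made at `k`, with surviving path
  -- `k`, `0`, `i`, `b`; two private neighbours of `k` are needed so that one differs from `0`.
  · obtain rfl : a = j := Fin.ext (by omega)
    have hleaf : ∀ a'' c, a'' < a → a < c → G.Adj c a'' → G.Adj c a →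
        i = a'' ∧ ∀ x, G.Adj c x → x ≠ a → x ≠ i → G.Adj i x := fun a'' c h1 h2 h3 h4 =>
      hopt.eq_of_forall_adj_lt hG hmono hdeg hmin h1 h2 h3 h4 (hlt.2 (by omega)) hij
        fun v hv hiv => by
          have := hlt.1 hiv
          have : v ≠ a := by rintro rfl; exact hij hv
          have := hval this
          exact hlt.2 (by omega)
    have h0 : ∀ c, a < c → G.Adj c a → ¬ G.Adj c 0 := fun c h1 h2 h3 =>
      h0i.ne' (hleaf 0 c (hlt.2 (by omega)) h1 h3 h2).1
    obtain ⟨rfl, hall⟩ := hleaf a' b ha' hab hba' hba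
    have hka : ¬ G.Adj k a := fun h => h0 k (hlt.2 (by omega)) h h0k.symm
    have hki : ¬ G.Adj k i := fun h => by
      have := Fin.le_def.1 (hmin 0 i k (hlt.2 (by omega)) (hlt.2 (by omega)) h0k.symm h)
      omega
    have hbk : b ≠ k := by rintro rfl; exact hka hba
    have hbk' : ¬ G.Adj b k := fun h => hki (hall k h (hne (by omega)) (hne (by omega))).symm
    have := hval hbk
    have hcard : 1 < (G.privateNeighbors k b).card := by
      refine lt_of_lt_of_le (Finset.one_lt_card.2 ⟨i, ?_, a, ?_, hne (by omega)⟩)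
        (card_privateNeighbors_le (hdeg (hlt.2 (by omega) : k < b).le))
      · exact mem_privateNeighbors.2 ⟨hba', hne (by omega), hki⟩
      · exact mem_privateNeighbors.2 ⟨hba, hne (by omega), hka⟩
    obtain ⟨y, hy, hy0⟩ := Finset.exists_mem_ne hcard 0
    obtain ⟨hky, hyb, hby⟩ := mem_privateNeighbors.1 hy
    have hyi : y ≠ i := by rintro rfl; exact hki hky
    have hya : y ≠ a := by rintro rfl; exact hka hky
    have := hval hy0
    have := hval hyi
    have := hval hya
    refine hopt k y b a hky hba hka hby (hne (by omega)) hyb.symm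
      (hlt.2 (by omega)) (hlt.2 (by omega)) (Or.inl ?_)
    have e1 : (G.deleteEdges {s(k, y), s(b, a)}).Adj k 0 :=
      deleteEdges_pair_adj.2 ⟨h0k.symm, by grind, by grind⟩
    have e2 : (G.deleteEdges {s(k, y), s(b, a)}).Adj 0 i :=
      deleteEdges_pair_adj.2 ⟨h0i, by grind, by grind⟩
    have e3 : (G.deleteEdges {s(k, y), s(b, a)}).Adj i b :=
      deleteEdges_pair_adj.2 ⟨hba'.symm, by grind, by grind⟩
    exact e1.reachable.trans (e2.reachable.trans e3.reachable)
  · have hleaf : ∀ u, u < a → ¬ G.Adj u a → (∀ v, G.Adj u v → u < v → a < v) → u = a' :=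
      fun u h1 h2 h3 =>
        (hopt.eq_of_forall_adj_lt hG hmono hdeg hmin ha' hab hba' hba h1 h2 h3).1
    by_cases h0a : G.Adj 0 a
    -- The tree is a star centred at `0`, so `i` and `j` are both leaves and both equal `a'`.
    · have key : ∀ u, u ≠ 0 → u < a → u = a' := by
        intro u hu0 hua
        have hu0' := hval hu0
        have h0u : 0 < u := hlt.2 (by omega)
        have hnot : ∀ v, G.Adj 0 v → u < v → ¬ G.Adj u v := fun v h0v huv h =>
          absurd (hmin 0 u v h0u huv h0v.symm h.symm) (not_le.2 hua)
        refine hleaf u hua (hnot a h0a hua) fun v huv hlt' => not_le.1 fun hva => ?_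
        exact hnot v (zero_adj_of_le hG hmono (h0u.trans hlt').ne' hva h0a) hlt' huv
      have := (key i h0i.ne' (hlt.2 (by omega))).trans (key j h0j.ne' (hlt.2 (by omega))).symm
      have := congrArg Fin.val this
      omega
    · have hak : a ≠ k := by rintro rfl; exact h0a h0k
      have := hval hak
      have hpar : ∀ x : Fin n, ∃ y, x ≠ 0 → y < x ∧ G.Adj x y := fun x => by
        by_cases hx : x = 0
        · exact ⟨0, fun h => absurd hx h⟩
        · obtain ⟨y, hy⟩ := exists_smaller_adj hG hmono hx
          exact ⟨y, fun _ => hy⟩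
      choose par hpar using hpar
      have hpar_eq : ∀ x y, x ≤ a → y < x → G.Adj x y → par x = y := fun x y hx hy hxy => by
        have hx0 : x ≠ 0 := (lt_of_le_of_lt (Fin.zero_le y) hy).ne'
        exact hmin.eq_of_adj hx (hpar x hx0).1 hy (hpar x hx0).2 hxy
      -- Every `u < a` is the parent of `a`, the leaf `a'`, or the parent of some `v < a`; this
      -- parent is `0` when `v ≤ k`. The right side has at most `3 + (a - 4)` elements, fewer than
      -- `a`.
      have hsub : Finset.Iio a ⊆
          insert (par a) (insert a' (insert 0 ((Finset.Ioo k a).image par))) := by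
        intro u hu
        rw [Finset.mem_Iio] at hu
        by_cases hua : G.Adj u a
        · simp [hpar_eq a u le_rfl hu hua.symm]
        by_cases hua' : u = a'
        · simp [hua']
        obtain ⟨v, huv, hlt', hva⟩ : ∃ v, G.Adj u v ∧ u < v ∧ v ≤ a := by
          by_contra! hc
          exact hua' (hleaf u hu hua hc)
        have hva' : v < a := lt_of_le_of_ne hva (by rintro rfl; exact hua huv)
        have hpv := hpar_eq v u hva hlt' huv.symm
        by_cases hkv : k < v
        · have : u ∈ (Finset.Ioo k a).image par :=
            Finset.mem_image.2 ⟨v, Finset.mem_Ioo.2 ⟨hkv, hva'⟩, hpv⟩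
          simp only [Finset.mem_insert, this, or_true]
        · have hv0 : v ≠ 0 := (lt_of_le_of_lt (Fin.zero_le u) hlt').ne'
          have h0v := zero_adj_of_le hG hmono hv0 (not_lt.1 hkv) h0k
          have := hpar_eq v 0 hva (lt_of_le_of_ne (Fin.zero_le v) hv0.symm) h0v.symm
          simp [← hpv, this]
      have c1 := Finset.card_le_card hsub
      have c2 := Finset.card_insert_le (par a) (insert a' (insert 0 ((Finset.Ioo k a).image par)))
      have c3 := Finset.card_insert_le a' (insert 0 ((Finset.Ioo k a).image par))
      have c4 := Finset.card_insert_le 0 ((Finset.Ioo k a).image par)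
      have c5 := Finset.card_image_le (s := Finset.Ioo k a) (f := par)
      rw [Fin.card_Iio] at c1
      rw [Fin.card_Ioo] at c5
      omega

end Triangle

end SimpleGraph

/-! ### Conclusion. -/

open SimpleGraph

open Classical in
theorem SimpleGraph.SwitchOptimal.isBFSOrdering {n : ℕ} [NeZero n] {G : SimpleGraph (Fin n)}
    (hG : G.Connected) (hdeg : Antitone fun i => G.degree i) (hopt : G.SwitchOptimal) :
    IsBFSOrdering G (Equiv.refl (Fin n)) where
  connected := hG
  degree_anti _ _ hij := hdeg hij
  dist_mono _ _ hij := hopt.dist_mono hG hdeg hij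
  children _ _ _ _ huv hwv hwz huz huw hv hz hlt :=
    hopt.children_lt hG huv hwv hwz huz huw hv hz hlt

open Classical in
theorem SimpleGraph.SwitchOptimal.firstThreeFormTriangle {n : ℕ} [NeZero n]
    {G : SimpleGraph (Fin n)} (hG : G.Connected) (hdeg : Antitone fun i => G.degree i)
    (hopt : G.SwitchOptimal) (hedge : n ≤ G.edgeFinset.card) (hleaf : ∃ i, G.degree i = 1) :
    FirstThreeFormTriangle G := by
  -- With all degrees at most 2 and one equal to 1, the degree sum would fall below `2 * n`. Only
  -- here does the vertex of degree 1 matter.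
  have h3 : 3 ≤ G.degree 0 := by
    by_contra! hlt
    obtain ⟨i, hi⟩ := hleaf
    have h1 : ∑ v, G.degree v < ∑ _v : Fin n, 2 := by
      refine Finset.sum_lt_sum (fun v _ => ?_) ⟨i, Finset.mem_univ _, by omega⟩
      have : G.degree v ≤ G.degree 0 := hdeg (Fin.zero_le v)
      omega
    rw [sum_degrees_eq_twice_card_edges] at h1
    simp only [Finset.sum_const, Finset.card_univ, Fintype.card_fin, smul_eq_mul] at h1
    omega
  have hn := G.degree_lt_card_verts 0
  rw [Fintype.card_fin] at hn
  have hmono := hopt.dist_mono hG hdeg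
  have hadj : ∀ (m : ℕ) (hm : m < n), m ≠ 0 → m ≤ 3 → G.Adj 0 ⟨m, hm⟩ := fun m hm h0 hm3 =>
    zero_adj_of_le_degree hG hmono (fun h => h0 (by simpa using congrArg Fin.val h))
      (hm3.trans h3)
  exact ⟨by omega, hadj 1 (by omega) (by omega) (by omega), hadj 2 (by omega) (by omega) (by omega),
    hopt.second_adj_third hG hdeg h3 hedge rfl rfl⟩

open Classical in
theorem IsCyclicDegreeSequence.exists_isMaxOn_isBFSOrdering {n : ℕ} [NeZero n] {c : ℕ}
    {d : Fin n → ℕ} (hd : IsCyclicDegreeSequence c d) (hleaf : ∃ i, d i = 1) {f : ℝ → ℝ → ℝ}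
    (hf : IsEscalating f) :
    ∃ G ∈ GraphsWithDegrees d,
      IsMaxOn (connectivity f) (GraphsWithDegrees d) G ∧
      IsBFSOrdering G (Equiv.refl (Fin n)) ∧
      (1 ≤ c → FirstThreeFormTriangle G) := by
  obtain ⟨hanti, H, hH, -, hHc⟩ := hd
  obtain ⟨G, hG, hmax, hopt⟩ := exists_isMaxOn_connectivity_switchOptimal hanti ⟨H, hH⟩ hf
  have hdeg : Antitone fun i => G.degree i := fun i j hij => by
    simpa only [hG.2] using hanti hij
  refine ⟨G, hG, hmax, hopt.isBFSOrdering hG.1 hdeg, fun hc => ?_⟩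
  refine hopt.firstThreeFormTriangle hG.1 hdeg ?_ ?_
  -- The degrees determine the number of edges, so `G` has as many as the `c`-cyclic graph `H`.
  · have h1 := G.sum_degrees_eq_twice_card_edges
    have h2 := H.sum_degrees_eq_twice_card_edges
    simp only [hG.2] at h1
    simp only [hH.2] at h2
    rw [Fintype.card_fin] at hHc
    omega
  · obtain ⟨i, hi⟩ := hleaf
    exact ⟨i, (hG.2 i).trans hi⟩

theorem mainTheorem1 {n : ℕ} [NeZero n] (c : ℕ) (d : Fin n → ℕ)
    (hd : IsCyclicDegreeSequence c d)
    (hlast : d ⟨n - 1, Nat.sub_lt (NeZero.pos n) one_pos⟩ = 1)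
    (f : ℝ → ℝ → ℝ) :
    (IsEscalating f →
      ∃ G ∈ GraphsWithDegrees d,
        IsMaxOn (connectivity f) (GraphsWithDegrees d) G ∧
        IsBFSOrdering G (Equiv.refl (Fin n)) ∧
        (1 ≤ c → FirstThreeFormTriangle G)) ∧
    (IsDeEscalating f →
      ∃ G ∈ GraphsWithDegrees d,
        IsMinOn (connectivity f) (GraphsWithDegrees d) G ∧
        IsBFSOrdering G (Equiv.refl (Fin n)) ∧
        (1 ≤ c → FirstThreeFormTriangle G)) := by
  have hleaf : ∃ i, d i = 1 := ⟨_, hlast⟩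
  refine ⟨fun hf => hd.exists_isMaxOn_isBFSOrdering hleaf hf, fun hf => ?_⟩
  obtain ⟨G, hG, hmax, h⟩ := hd.exists_isMaxOn_isBFSOrdering hleaf hf.neg
  refine ⟨G, hG, fun H hH => ?_, h⟩
  have := hmax hH
  simp only [Set.mem_ofPred_eq, connectivity_neg] at this ⊢
  exact neg_le_neg_iff.1 this
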